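/- Let $\mathcal L$ be the twisted Heisenberg--Virasoro algebra: the complex Lie algebra with basis $\{d_n, I_n, z_1,z_2,z_3 \mid n\in\mathbb Z\}$ and brackets $$[d_n,d_m]=(m-n)d_{m+n}+\delta_{n,-m}\tfrac{n^3-n}{12}z_1,\quad [d_n,I_m]=mI_{m+n}+\delta_{n,-m}(n^2+n)z_2,\quad [I_n,I_m]=n\,\delta_{n,-m}z_3,$$ with $z_1,z_2,z_3$ central. Let $\mathrm{Vir}=\mathrm{span}\{d_n,z_1\mid n\in\mathbb Z\}$ and $\mathcal H=\mathrm{span}\{I_n,z_3\mid n\in\mathbb Z\}$ be its Virasoro and Heisenberg subalgebras. Let $\mathcal O_{\mathcal H}$ be the category of all $\mathcal H$-modules $H$ such that for every $v\in H$ there is a positive integer $n$ with $I_iv=0$ for all $i\ge n$. For a $\mathrm{Vir}$-module $V$, let $V^{\mathcal L}$ be the $\mathcal L$-module obtained from $V$ by letting $\mathcal H$ and $z_2$ act as zero. For a simple module $H\in\mathcal O_{\mathcal H}$ on which $z_3$ acts nontrivially, hence as a nonzero scalar $c$, and for $\lambda\in\mathbb C$, let $H(\lambda)$ be the $\mathcal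 L$-module structure on $H$ that extends the $\mathcal H$-module structure by $$z_1=1-\frac{12\lambda^2}{c},\qquad z_2=\lambda,\qquad d_k=-\frac1{2c}\sum_{i\in\mathbb Z}{:}I_{-i}I_{i+k}{:}+\frac{(k+1)\lambda}{c}I_k\quad(k\in\mathbb Z),$$ where ${:}I_iI_j{:}$ is $I_iI_j$ if $i<j$ and $I_jI_i$ otherwise (on each vector only finitely many terms of the sum are nonzero). **Theorem.** Let $\lambda,\mu\in\mathbb C$, let $V,W$ be $\mathrm{Vir}$-modules, and let $H,K\in\mathcal O_{\mathcal H}$ be simple with nonzero action of $z_3$. 1. Every $\mathcal L$-submodule of $V^{\mathcal L}\otimes H(\lambda)$ is of the form $(V')^{\mathcal L}\otimes H(\lambda)$ for a $\mathrm{Vir}$-submodule $V'$ of $V$. In particular, $V^{\mathcal L}\otimes H(\lambda)$ is a simple $\mathcal L$-module if and only if $V$ is a simple $\mathrm{Vir}$-module. 2. Suppose that $V$ and $W$ are not both zero. Then $V^{\mathcal L}\otimes H(\lambda)\cong W^{\mathcal L}\otimes K(\mu)$ as $\mathcal L$-modules if and only if $\lambda=\mu$, $V\cong W$ as $\mathrm{Vir}$-modules,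 and $H\cong K$ as $\mathcal H$-modules. -/

import Mathlib

/-! The twisted Heisenberg–Virasoro algebra. -/

noncomputable section

namespace HeisVir

/-- Labels of the basis `d n = t^(n+1) d/dt`, `I n = t^n`, `z1`, `z2`, `z3`. -/
inductive Gen : Type
  | d (n : ℤ)
  | I (n : ℤ)
  | z1
  | z2
  | z3

/-- The underlying vector space of the twisted Heisenberg–Virasoro algebra. -/
def LL : Type := Gen →₀ ℂ

instance : AddCommGroup LL := inferInstanceAs (AddCommGroup (Gen →₀ ℂ))
instance : Module ℂ LL := inferInstanceAs (Module ℂ (Gen →₀ ℂ))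

/-- The defining basis of the twisted Heisenberg–Virasoro algebra. -/
def basis : Module.Basis Gen ℂ LL := ⟨LinearEquiv.refl ℂ (Gen →₀ ℂ)⟩

/-- A basis vector, as an element of the algebra. -/
def gen (g : Gen) : LL := basis g

/-- The brackets of basis vectors. -/
def genBracket : Gen → Gen → LL
  | .d n, .d m => ((m : ℂ) - n) • gen (.d (m + n)) +
      (if n = -m then ((n : ℂ) ^ 3 - n) / 12 else 0) • gen .z1
  | .d n, .I m => (m : ℂ) • gen (.I (m + n)) +
      (if n = -m then (n : ℂ) ^ 2 + n else 0) • gen .z2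
  | .I m, .d n => -((m : ℂ) • gen (.I (m + n)) +
      (if n = -m then (n : ℂ) ^ 2 + n else 0) • gen .z2)
  | .I n, .I m => (if n = -m then (n : ℂ) else 0) • gen .z3
  | _, _ => 0

/-- The bilinear extension of `genBracket`. -/
def bracketHom : LL →ₗ[ℂ] LL →ₗ[ℂ] LL :=
  basis.constr ℂ fun g => basis.constr ℂ fun h => genBracket g h

theorem bracketHom_gen (g h : Gen) : bracketHom (gen g) (gen h) = genBracket g h := by
  simp [bracketHom, gen]

theorem bracketHom_skew (x y : LL) : bracketHom x y = -bracketHom y x := by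
  have : bracketHom = -bracketHom.flip := by
    refine basis.ext fun g => basis.ext fun h => ?_
    change bracketHom (gen g) (gen h) = -bracketHom (gen h) (gen g)
    rw [bracketHom_gen, bracketHom_gen]
    rcases g with n | n | _ | _ | _ <;> rcases h with m | m | _ | _ | _ <;>
      simp only [genBracket, neg_neg, neg_zero]
    · rw [add_comm n m]
      by_cases hnm : n = -m
      · subst hnm
        simp only [if_true, neg_neg]
        push_cast
        module
      · have : ¬ m = -n := by omega
        simp only [hnm, this, if_false]
        module
    · by_cases hnm : n = -m
      · subst hnm
        simp only [if_true, neg_neg]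
        push_cast
        module
      · have : ¬ m = -n := by omega
        simp [hnm, this]
  exact congrArg (fun f => f x y) this

@[elab_as_elim]
theorem gen_induction {p : LL → Prop} (x : LL) (hgen : ∀ g, p (gen g))
    (hadd : ∀ x y, p x → p y → p (x + y)) (hsmul : ∀ (c : ℂ) x, p x → p (c • x)) : p x := by
  have hx : x ∈ Submodule.span ℂ (Set.range basis) := by
    rw [basis.span_eq]
    trivial
  induction hx using Submodule.span_induction with
  | mem x h =>
    obtain ⟨g, rfl⟩ := h
    exact hgen g
  | zero =>
    have := hsmul 0 _ (hgen .z1)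
    rwa [zero_smul] at this
  | add x y _ _ hx hy => exact hadd x y hx hy
  | smul c x _ hx => exact hsmul c x hx

theorem bracketHom_jacobi_gen (g h k : Gen) :
    bracketHom (gen g) (bracketHom (gen h) (gen k)) =
      bracketHom (bracketHom (gen g) (gen h)) (gen k) +
        bracketHom (gen h) (bracketHom (gen g) (gen k)) := by
  simp only [bracketHom_gen]
  rcases g with n | n | _ | _ | _ <;> rcases h with m | m | _ | _ | _ <;>
    rcases k with l | l | _ | _ | _ <;>
    simp only [genBracket, map_add, map_smul, map_neg, map_zero, LinearMap.add_apply,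
      LinearMap.smul_apply, LinearMap.neg_apply, LinearMap.zero_apply, bracketHom_gen, smul_zero,
      add_zero, neg_zero]
  all_goals
    try simp only [show l + m + n = n + m + l by ring, show l + (m + n) = n + m + l by ring,
      show l + n + m = n + m + l by ring, show m + l + n = n + m + l by ring,
      show m + n + l = n + m + l by ring, show m + (l + n) = n + m + l by ring,
      show n + (l + m) = n + m + l by ring, show n + l + m = n + m + l by ring]
    by_cases hs : l = -(n + m)
    · have hs1 : n = -(l + m) := by omega
      have hs2 : m = -(l + n) := by omega
      have hs3 : l = -(m + n) := by omega
      have hs4 : m + n = -l := by omega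
      have hs5 : n + m = -l := by omega
      have hs6 : n = -(m + l) := by omega
      have hs7 : m = -(n + l) := by omega
      have hs8 : l + n = -m := by omega
      have hs9 : l + m = -n := by omega
      rw [if_pos (by assumption), if_pos (by assumption)]
      try rw [if_pos (by assumption)]
      have hc : (l : ℂ) = -(n + m) := by exact_mod_cast hs
      push_cast
      try rw [hc]
      module
    · rw [if_neg (by omega), if_neg (by omega)]
      try rw [if_neg (by omega)]
      push_cast
      module

theorem bracketHom_jacobi (x y z : LL) :
    bracketHom x (bracketHom y z) =
      bracketHom (bracketHom x y) z + bracketHom y (bracketHom x z) := by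
  induction x using gen_induction with
  | hgen g =>
    induction y using gen_induction with
    | hgen h =>
      induction z using gen_induction with
      | hgen k => exact bracketHom_jacobi_gen g h k
      | hadd z w hz hw => simp only [map_add, hz, hw]; abel
      | hsmul c z hz => simp only [map_smul, hz, smul_add]
    | hadd y w hy hw => simp only [map_add, LinearMap.add_apply, hy, hw]; abel
    | hsmul c y hy => simp only [map_smul, LinearMap.smul_apply, hy, smul_add]
  | hadd x w hx hw => simp only [map_add, LinearMap.add_apply, hx, hw]; abel
  | hsmul c x hx => simp only [map_smul, LinearMap.smul_apply, hx, smul_add]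

instance : LieRing LL where
  bracket x y := bracketHom x y
  add_lie x y z := by simp
  lie_add x y z := by simp
  lie_self x := by
    have h := eq_neg_iff_add_eq_zero.mp (bracketHom_skew x x)
    rw [← two_smul ℂ] at h
    exact (smul_eq_zero.mp h).resolve_left two_ne_zero
  leibniz_lie x y z := bracketHom_jacobi x y z

instance : LieAlgebra ℂ LL where
  lie_smul c x y := map_smul (bracketHom x) c y

theorem lie_gen (g h : Gen) : ⁅gen g, gen h⁆ = genBracket g h := bracketHom_gen g h

/-- A subspace spanned by a set closed under the bracket up to linear combinations. -/
theorem lie_mem_span {s : Set LL} (h : ∀ x ∈ s, ∀ y ∈ s, ⁅x, y⁆ ∈ Submodule.span ℂ s) {x y : LL}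
    (hx : x ∈ Submodule.span ℂ s) (hy : y ∈ Submodule.span ℂ s) :
    ⁅x, y⁆ ∈ Submodule.span ℂ s := by
  induction hx using Submodule.span_induction with
  | mem x hx =>
    induction hy using Submodule.span_induction with
    | mem y hy => exact h x hx y hy
    | zero => simp
    | add y z _ _ h1 h2 => rw [lie_add]; exact add_mem h1 h2
    | smul c y _ h1 => rw [lie_smul]; exact Submodule.smul_mem _ c h1
  | zero => simp
  | add y z _ _ h1 h2 => rw [add_lie]; exact add_mem h1 h2
  | smul c y _ h1 => rw [smul_lie]; exact Submodule.smul_mem _ c h1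

/-- The Virasoro subalgebra, with basis `d n`, `z1`. -/
def Vir : LieSubalgebra ℂ LL where
  toSubmodule := Submodule.span ℂ (Set.range (fun n => gen (.d n)) ∪ {gen .z1})
  lie_mem' := by
    refine lie_mem_span ?_
    have hd (n : ℤ) : gen (.d n) ∈ Submodule.span ℂ
        (Set.range (fun n => gen (.d n)) ∪ {gen .z1}) := Submodule.subset_span (by simp)
    have hz : gen .z1 ∈ Submodule.span ℂ
        (Set.range (fun n => gen (.d n)) ∪ {gen .z1}) := Submodule.subset_span (by simp)
    rintro _ (⟨n, rfl⟩ | rfl) _ (⟨m, rfl⟩ | rfl) <;> simp only [lie_gen, genBracket]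
    · exact add_mem (Submodule.smul_mem _ _ (hd _)) (Submodule.smul_mem _ _ hz)
    all_goals exact zero_mem _

/-- The Heisenberg subalgebra, with basis `I n`, `z3`. -/
def Heis : LieSubalgebra ℂ LL where
  toSubmodule := Submodule.span ℂ (Set.range (fun n => gen (.I n)) ∪ {gen .z3})
  lie_mem' := by
    refine lie_mem_span ?_
    have hz : gen .z3 ∈ Submodule.span ℂ
        (Set.range (fun n => gen (.I n)) ∪ {gen .z3}) := Submodule.subset_span (by simp)
    rintro _ (⟨n, rfl⟩ | rfl) _ (⟨m, rfl⟩ | rfl) <;> simp only [lie_gen, genBracket]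
    · exact Submodule.smul_mem _ _ hz
    all_goals exact zero_mem _

/-- The element `d n` of the Virasoro algebra. -/
def Vir.d (n : ℤ) : Vir := ⟨gen (.d n), Submodule.subset_span (by simp)⟩

/-- The central element `z1` of the Virasoro algebra. -/
def Vir.z1 : Vir := ⟨gen .z1, Submodule.subset_span (by simp)⟩

/-- The element `I n` of the Heisenberg algebra. -/
def Heis.I (n : ℤ) : Heis := ⟨gen (.I n), Submodule.subset_span (by simp)⟩

/-- The central element `z3` of the Heisenberg algebra. -/
def Heis.z3 : Heis := ⟨gen .z3, Submodule.subset_span (by simp)⟩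

/-- The projection onto the Virasoro subalgebra, as a linear map: the identity on `d n` and `z1`,
zero on `I n`, `z2` and `z3`. -/
def projLin : LL →ₗ[ℂ] Vir := basis.constr ℂ fun g =>
  match g with
  | .d n => Vir.d n
  | .z1 => Vir.z1
  | _ => 0

@[simp] theorem projLin_d (n : ℤ) : projLin (gen (.d n)) = Vir.d n := by simp [projLin, gen]
@[simp] theorem projLin_I (n : ℤ) : projLin (gen (.I n)) = 0 := by simp [projLin, gen]
@[simp] theorem projLin_z1 : projLin (gen .z1) = Vir.z1 := by simp [projLin, gen]
@[simp] theorem projLin_z2 : projLin (gen .z2) = 0 := by simp [projLin, gen]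
@[simp] theorem projLin_z3 : projLin (gen .z3) = 0 := by simp [projLin, gen]

/-- The projection of the twisted Heisenberg–Virasoro algebra onto the Virasoro subalgebra, with
kernel `Heis + ℂ z2`. -/
def proj : LL →ₗ⁅ℂ⁆ Vir where
  toLinearMap := projLin
  map_lie' := by
    intro x y
    change projLin ⁅x, y⁆ = ⁅projLin x, projLin y⁆
    induction x using gen_induction with
    | hgen g =>
      induction y using gen_induction with
      | hgen h =>
        apply Subtype.ext
        rw [lie_gen, LieSubalgebra.coe_bracket]
        rcases g with n | n | _ | _ | _ <;> rcases h with m | m | _ | _ | _ <;>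
          simp [genBracket, Vir.d, Vir.z1, lie_gen, -ite_smul]
      | hadd y z h1 h2 => simp only [lie_add, map_add, h1, h2]
      | hsmul c y h1 => simp only [lie_smul, map_smul, h1]
    | hadd y z h1 h2 => simp only [add_lie, map_add, h1, h2]
    | hsmul c y h1 => simp only [smul_lie, map_smul, h1]

theorem proj_coe (x : Vir) : proj (x : LL) = x := by
  obtain ⟨x, hx⟩ := x
  change projLin x = _
  have hx' : x ∈ Submodule.span ℂ (Set.range (fun n => gen (.d n)) ∪ {gen .z1}) := hx
  apply Subtype.ext
  change (projLin x : LL) = x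
  clear hx
  induction hx' using Submodule.span_induction with
  | mem x h =>
    rcases h with ⟨n, rfl⟩ | rfl
    · exact congrArg Subtype.val (projLin_d n)
    · exact congrArg Subtype.val projLin_z1
  | zero => simp
  | add x y _ _ h1 h2 => rw [map_add]; exact congrArg₂ (· + ·) h1 h2
  | smul c x _ h1 => rw [map_smul]; exact congrArg (c • ·) h1

/-- A `Vir`-module `V`, regarded as a module over the whole algebra with `Heis + ℂ z2` acting
as zero. -/
def Inflation (V : Type*) : Type _ := V

section Inflation

variable (V : Type*) [AddCommGroup V] [Module ℂ V] [LieRingModule Vir V] [LieModule ℂ Vir V]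

instance : AddCommGroup (Inflation V) := inferInstanceAs (AddCommGroup V)
instance : Module ℂ (Inflation V) := inferInstanceAs (Module ℂ V)
instance : LieRingModule LL (Inflation V) := LieRingModule.compLieHom V proj
instance : LieModule ℂ LL (Inflation V) := LieModule.compLieHom V proj

variable {V}

/-- A `Vir`-submodule `V'` of `V`, regarded as a submodule over the whole algebra. -/
def inflationSubmodule (V' : LieSubmodule ℂ Vir V) : LieSubmodule ℂ LL (Inflation V) where
  carrier := (V' : Set V)
  add_mem' h1 h2 := V'.add_mem h1 h2
  zero_mem' := V'.zero_mem
  smul_mem' c _ h := V'.smul_mem c h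
  lie_mem {x _} h := V'.lie_mem (x := proj x) h

end Inflation

/-- **Schur's lemma** for a simple module over a Lie algebra of countable dimension. -/
theorem exists_scalar {L M : Type*} [LieRing L] [LieAlgebra ℂ L] [AddCommGroup M] [Module ℂ M]
    [LieRingModule L M] [LieModule ℂ L M] (hM : LieModule.IsIrreducible ℂ L M) {s : Set L}
    (hs : s.Countable) (hspan : Submodule.span ℂ s = ⊤) (f : M →ₗ⁅ℂ,L⁆ M) :
    ∃ c : ℂ, ∀ m, f m = c • m := by
  by_contra! hf
  have hnt : Nontrivial M := by
    obtain ⟨m, hm⟩ := hf 0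
    exact ⟨m, 0, fun h => hm (by simp [h])⟩
  obtain ⟨v, hv⟩ := exists_ne (0 : M)
  -- the dimension of `M` is countable
  have hrank : Module.rank ℂ M ≤ Cardinal.aleph0 := by
    let t : Set M := Set.range fun l : List s => l.foldr (fun x m => ⁅(x : L), m⁆) v
    have : Countable s := hs
    have ht : t.Countable := Set.countable_range _
    let N : LieSubmodule ℂ L M :=
      { Submodule.span ℂ t with
        lie_mem := by
          intro x m hm
          change m ∈ Submodule.span ℂ t at hm
          change ⁅x, m⁆ ∈ Submodule.span ℂ t
          have hx : x ∈ Submodule.span ℂ s := hspan ▸ Submodule.mem_top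
          induction hx using Submodule.span_induction with
          | mem x hx =>
            induction hm using Submodule.span_induction with
            | mem m hm =>
              obtain ⟨l, rfl⟩ := hm
              exact Submodule.subset_span ⟨⟨x, hx⟩ :: l, rfl⟩
            | zero => simp
            | add y z _ _ h1 h2 => rw [lie_add]; exact add_mem h1 h2
            | smul c y _ h1 => rw [lie_smul]; exact Submodule.smul_mem _ c h1
          | zero => simp
          | add y z _ _ h1 h2 => rw [add_lie]; exact add_mem h1 h2
          | smul c y _ h1 => rw [smul_lie]; exact Submodule.smul_mem _ c h1 }
    have hvN : v ∈ N := Submodule.subset_span ⟨[], rfl⟩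
    have hN : N = ⊤ := (hM.eq_bot_or_eq_top N).resolve_left fun h => hv (by simpa [h] using hvN)
    have htop : Submodule.span ℂ t = ⊤ := by
      rw [eq_top_iff]
      intro m _
      have : m ∈ N := hN ▸ LieSubmodule.mem_top m
      exact this
    rw [← rank_top ℂ M, ← htop]
    exact (rank_span_le t).trans ht.le_aleph0
  -- every `f - c` is bijective
  have hunit (c : ℂ) : IsUnit (algebraMap ℂ (Module.End ℂ M) c - (f : M →ₗ[ℂ] M)) := by
    rw [Module.End.isUnit_iff]
    let g : M →ₗ⁅ℂ,L⁆ M := c • LieModuleHom.id - f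
    have hg : ∀ m, g m = c • m - f m := fun m => rfl
    have hker : g.ker = ⊥ := (hM.eq_bot_or_eq_top g.ker).resolve_right fun h => by
      obtain ⟨m, hm⟩ := hf c
      have : m ∈ g.ker := h ▸ LieSubmodule.mem_top m
      rw [LieModuleHom.mem_ker, hg, sub_eq_zero] at this
      exact hm this.symm
    have hran : g.range = ⊤ := (hM.eq_bot_or_eq_top g.range).resolve_left fun h => by
      obtain ⟨m, hm⟩ := hf c
      have : g m ∈ g.range := ⟨m, rfl⟩
      rw [h, LieSubmodule.mem_bot, hg, sub_eq_zero] at this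
      exact hm this.symm
    exact ⟨LieModuleHom.ker_eq_bot _ |>.mp hker, LieModuleHom.range_eq_top _ |>.mp hran⟩
  have hspec : spectrum ℂ (f : M →ₗ[ℂ] M) = ∅ := by
    ext c
    simp [spectrum.mem_iff, hunit c]
  have hinj (p : Polynomial ℂ) (hp : p ≠ 0) (m : M)
      (hm : Polynomial.aeval (f : M →ₗ[ℂ] M) p m = 0) : m = 0 := by
    have h1 : IsUnit (Polynomial.aeval (f : M →ₗ[ℂ] M)
        (Multiset.map (fun x : ℂ => Polynomial.X - Polynomial.C x) p.roots).prod) := by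
      by_contra h
      obtain ⟨k, hk, -⟩ := spectrum.exists_mem_of_not_isUnit_aeval_prod h
      rw [hspec] at hk
      exact hk
    rw [(IsAlgClosed.splits p).eq_prod_roots, map_mul, Polynomial.aeval_C,
      Module.End.mul_apply, Module.algebraMap_end_apply, smul_eq_zero] at hm
    have h2 := hm.resolve_left (by simpa using hp)
    exact (Module.End.isUnit_iff _ |>.mp h1).1 (by rw [h2, map_zero])
  choose w hw using fun c : ℂ => ((Module.End.isUnit_iff _).mp (hunit c)).2 v
  have hli : LinearIndependent ℂ w := by
    rw [linearIndependent_iff']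
    intro s g hg i hi
    classical
    let q : ℂ → Polynomial ℂ := fun j => ∏ k ∈ s.erase j, (Polynomial.C k - Polynomial.X)
    let p : Polynomial ℂ := ∑ j ∈ s, Polynomial.C (g j) * q j
    have hpv : Polynomial.aeval (f : M →ₗ[ℂ] M) p v = 0 := by
      have h1 : ∀ j ∈ s, Polynomial.aeval (f : M →ₗ[ℂ] M) (Polynomial.C (g j) * q j) v =
          Polynomial.aeval (f : M →ₗ[ℂ] M) (∏ k ∈ s, (Polynomial.C k - Polynomial.X))
            (g j • w j) := by
        intro j hj
        have h2 : Polynomial.aeval (f : M →ₗ[ℂ] M) (Polynomial.C j - Polynomial.X) (w j) = v := by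
          rw [← hw j]
          simp
        rw [← Finset.prod_erase_mul _ _ hj, map_mul, map_mul, Module.End.mul_apply, map_smul,
          Module.End.mul_apply, h2, Polynomial.aeval_C]
        simp only [q, Module.algebraMap_end_apply]
      rw [map_sum, LinearMap.sum_apply, Finset.sum_congr rfl h1, ← map_sum, hg, map_zero]
    have hp : p = 0 := by
      by_contra hp
      exact hv (hinj p hp v hpv)
    have h3 : Polynomial.eval i p = g i * ∏ k ∈ s.erase i, (k - i) := by
      simp only [p, q, Polynomial.eval_finsetSum, Polynomial.eval_mul, Polynomial.eval_C,
        Polynomial.eval_prod, Polynomial.eval_sub, Polynomial.eval_X]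
      refine Finset.sum_eq_single i (fun j hj hji => ?_) (fun h => absurd hi h)
      rw [Finset.prod_eq_zero (i := i) (by simp [hi, hji.symm]) (by simp), mul_zero]
    rw [hp, Polynomial.eval_zero] at h3
    refine (mul_eq_zero.mp h3.symm).resolve_right ?_
    refine Finset.prod_ne_zero_iff.mpr ?_
    intro k hk
    exact sub_ne_zero.mpr (Finset.ne_of_mem_erase hk)
  have h1 := hli.cardinal_lift_le_rank
  have h2 := h1.trans (Cardinal.lift_le.mpr hrank)
  rw [Cardinal.mk_complex, Cardinal.lift_continuum, Cardinal.lift_aleph0] at h2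
  exact absurd h2 (not_le.mpr Cardinal.aleph0_lt_continuum)

theorem z3_lie (x : LL) : ⁅gen .z3, x⁆ = 0 := by
  induction x using gen_induction with
  | hgen g => rw [lie_gen]; rfl
  | hadd x y hx hy => rw [lie_add, hx, hy, add_zero]
  | hsmul c x hx => rw [lie_smul, hx, smul_zero]

theorem Heis.span_eq_top : Submodule.span ℂ (Set.range Heis.I ∪ {Heis.z3}) = ⊤ := by
  rw [eq_top_iff]
  rintro ⟨x, hx⟩ -
  have hx' : x ∈ Submodule.span ℂ (Set.range (fun n => gen (.I n)) ∪ {gen .z3}) := hx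
  induction hx' using Submodule.span_induction with
  | mem x h =>
    refine Submodule.subset_span ?_
    rcases h with ⟨n, rfl⟩ | h
    · exact Or.inl ⟨n, rfl⟩
    · exact Or.inr (Subtype.ext h)
  | zero => exact zero_mem _
  | add x y h1 h2 h3 h4 => exact add_mem (h3 h1) (h4 h2)
  | smul c x h1 h2 => exact Submodule.smul_mem _ c (h2 h1)

section Oscillator

variable (H : Type*) [AddCommGroup H] [Module ℂ H] [LieRingModule Heis H] [LieModule ℂ Heis H]

/-- The category `O` of `Heis`-modules: every vector is killed by all components `ℂ I i` of
sufficiently large degree `i`. -/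
def InCategoryO : Prop :=
  ∀ v : H, ∃ n : ℕ, 0 < n ∧ ∀ i : ℤ, (n : ℤ) ≤ i → ⁅Heis.I i, v⁆ = 0

/-- `H` is simple, lies in the category `O`, and the action of `z3` on it is nonzero. -/
structure IsChargedSimple : Prop where
  simple : LieModule.IsIrreducible ℂ Heis H
  inO : InCategoryO H
  z3_ne_zero : ∃ v : H, ⁅Heis.z3, v⁆ ≠ 0

/-- The action of `z3`, as a module endomorphism. -/
def z3Hom : H →ₗ⁅ℂ,Heis⁆ H where
  toLinearMap := LieModule.toEnd ℂ Heis H Heis.z3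
  map_lie' := by
    intro x v
    change ⁅Heis.z3, ⁅x, v⁆⁆ = ⁅x, ⁅Heis.z3, v⁆⁆
    have h : ⁅Heis.z3, x⁆ = 0 := Subtype.ext (z3_lie x)
    rw [leibniz_lie, h, zero_lie, zero_add]

variable {H}

theorem IsChargedSimple.exists_level (hH : IsChargedSimple H) :
    ∃ c : ℂ, ∀ v : H, ⁅Heis.z3, v⁆ = c • v :=
  exists_scalar hH.simple ((Set.countable_range _).union (Set.countable_singleton _))
    Heis.span_eq_top (z3Hom H)

/-- The scalar by which `z3` acts. -/
def IsChargedSimple.level (hH : IsChargedSimple H) : ℂ := hH.exists_level.choose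

theorem IsChargedSimple.z3_lie (hH : IsChargedSimple H) (v : H) : ⁅Heis.z3, v⁆ = hH.level • v :=
  hH.exists_level.choose_spec v

theorem IsChargedSimple.level_ne_zero (hH : IsChargedSimple H) : hH.level ≠ 0 := by
  intro h
  obtain ⟨v, hv⟩ := hH.z3_ne_zero
  exact hv (by rw [hH.z3_lie, h, zero_smul])

variable (H) in
/-- The operator by which `I i` acts. -/
def opI (i : ℤ) : Module.End ℂ H := LieModule.toEnd ℂ Heis H (Heis.I i)

variable (H) in
/-- The normally ordered product `:I_i I_j:`. -/
def normalOrder (i j : ℤ) : Module.End ℂ H :=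
  if i < j then opI H i * opI H j else opI H j * opI H i

theorem IsChargedSimple.opI_comm (hH : IsChargedSimple H) (i j : ℤ) (v : H) :
    opI H i (opI H j v) = opI H j (opI H i v) + (if i = -j then i * hH.level else 0) • v := by
  change ⁅Heis.I i, ⁅Heis.I j, v⁆⁆ = ⁅Heis.I j, ⁅Heis.I i, v⁆⁆ + _
  have h : ⁅Heis.I i, Heis.I j⁆ = (if i = -j then (i : ℂ) else 0) • Heis.z3 :=
    Subtype.ext (lie_gen _ _)
  rw [leibniz_lie, h, smul_lie, hH.z3_lie, add_comm, smul_smul, ite_mul, zero_mul]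

theorem IsChargedSimple.normalOrder_apply (hH : IsChargedSimple H) (k i : ℤ) (v : H) :
    normalOrder H (-i) (i + k) v = opI H (-i) (opI H (i + k) v) +
      (if k = 0 then (min i 0 : ℤ) * hH.level else 0) • v := by
  unfold normalOrder
  split_ifs with h1 h2 h2
  · subst h2
    rw [min_eq_right (by omega)]
    simp
  · simp
  · subst h2
    rw [min_eq_left (by omega), add_zero, Module.End.mul_apply, hH.opI_comm, if_pos (neg_neg i).symm]
  · rw [Module.End.mul_apply, hH.opI_comm, if_neg (by omega)]

theorem IsChargedSimple.support_finite (hH : IsChargedSimple H) (k : ℤ) (v : H) :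
    (Function.support fun i : ℤ => normalOrder H (-i) (i + k) v).Finite := by
  obtain ⟨n, -, hn⟩ := hH.inO v
  have hn' (j : ℤ) (hj : (n : ℤ) ≤ j) : opI H j v = 0 := hn j hj
  refine (Set.finite_Icc (-n : ℤ) (n - k)).subset fun i hi => ?_
  rw [Function.mem_support] at hi
  by_contra hc
  refine hi ?_
  rw [Set.mem_Icc, not_and_or] at hc
  unfold normalOrder
  split_ifs with h
  · rw [Module.End.mul_apply, hn' _ (by omega), map_zero]
  · rw [Module.End.mul_apply, hn' _ (by omega), map_zero]

/-- The sum of all `:I_{-i} I_{i+k}:` over the integers `i`; only finitely many terms are nonzero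
on each vector. -/
def IsChargedSimple.sumOp (hH : IsChargedSimple H) (k : ℤ) : Module.End ℂ H where
  toFun v := ∑ᶠ i : ℤ, normalOrder H (-i) (i + k) v
  map_add' v w := by
    simp only [map_add]
    exact finsum_add_distrib (hH.support_finite k v) (hH.support_finite k w)
  map_smul' c v := by
    simp only [map_smul, RingHom.id_apply]
    exact (smul_finsum c _).symm

/-- The operator by which `d k` acts in the oscillator representation. -/
def IsChargedSimple.opD (hH : IsChargedSimple H) (lam : ℂ) (k : ℤ) : Module.End ℂ H :=
  (-(1 / (2 * hH.level))) • hH.sumOp k + (((k : ℂ) + 1) * lam / hH.level) • opI H k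

theorem IsChargedSimple.sumOp_opI (hH : IsChargedSimple H) (k m : ℤ) (v : H) :
    hH.sumOp k (opI H m v) = opI H m (hH.sumOp k v) - (2 * m * hH.level) • opI H (m + k) v := by
  change ∑ᶠ i : ℤ, normalOrder H (-i) (i + k) (opI H m v) =
    opI H m (∑ᶠ i : ℤ, normalOrder H (-i) (i + k) v) - _
  have h0 := (opI H m).toAddMonoidHom.map_finsum (hH.support_finite k v)
  have h1 : Function.HasFiniteSupport fun i : ℤ => opI H m (normalOrder H (-i) (i + k) v) :=
    (hH.support_finite k v).subset fun i hi hi' => hi (by simp [hi'])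
  simp only [LinearMap.toAddMonoidHom_coe] at h0
  rw [h0, eq_sub_iff_add_eq, add_comm, ← eq_sub_iff_add_eq,
    ← neg_inj, neg_sub, ← finsum_sub_distrib (hH.support_finite k _) h1]
  have h2 (i : ℤ) : normalOrder H (-i) (i + k) (opI H m v) -
      opI H m (normalOrder H (-i) (i + k) v) =
      (if i = -m - k then -((m * hH.level) • opI H (m + k) v) else 0) +
      (if i = m then -((m * hH.level) • opI H (m + k) v) else 0) := by
    rw [hH.normalOrder_apply, hH.normalOrder_apply, hH.opI_comm (i + k) m, map_add, map_smul,
      hH.opI_comm (-i) m, map_add, map_smul]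
    by_cases ha : i = -m - k
    · have hb : i + k = -m := by omega
      have hd : -i = m + k := by omega
      have hb' : (↑(i + k) : ℂ) = -m := by rw [hb]; push_cast; rfl
      by_cases he : i = m
      · have hd' : -i = -m := by omega
        have hf : i + k = m + k := by omega
        have hg : ((-i : ℤ) : ℂ) = -m := by rw [hd']; push_cast; rfl
        rw [if_pos hb, if_pos hd', if_pos ha, if_pos he, hb', hg, hf, hd]
        module
      · rw [if_pos hb, if_neg (by omega : ¬ -i = -m), if_pos ha, if_neg he, hb', hd]
        module
    · rw [if_neg (by omega : ¬ i + k = -m), if_neg ha]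
      by_cases he : i = m
      · subst he
        rw [if_pos rfl, if_pos rfl]
        push_cast
        module
      · rw [if_neg (by omega : ¬ -i = -m), if_neg he]
        module
  rw [finsum_congr h2, finsum_add_distrib, finsum_eq_single _ (-m - k), finsum_eq_single _ m,
    if_pos rfl, if_pos rfl]
  · module
  · intro x hx
    rw [if_neg hx]
  · intro x hx
    rw [if_neg hx]
  · exact (Set.finite_singleton (-m - k)).subset fun i hi => by_contra fun h => hi (if_neg h)
  · exact (Set.finite_singleton m).subset fun i hi => by_contra fun h => hi (if_neg h)

/-- The integers whose sum produces the Virasoro cocycle. -/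
theorem cocycle_term (k i : ℤ) (hi : i ∉ Set.Ico (-|k|) |k|) :
    i * min (i - k) 0 - (i - k) * min i 0 = 0 := by
  rw [Set.mem_Ico, not_and_or] at hi
  rcases le_total 0 k with hk | hk
  · rw [abs_of_nonneg hk] at hi
    by_cases h : k ≤ i
    · rw [min_eq_right (by omega), min_eq_right (by omega)]; ring
    · rw [min_eq_left (by omega), min_eq_left (by omega)]; ring
  · rw [abs_of_nonpos hk] at hi
    by_cases h : 0 ≤ i
    · rw [min_eq_right (by omega), min_eq_right (by omega)]; ring
    · rw [min_eq_left (by omega), min_eq_left (by omega)]; ring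

theorem cocycle_support (k : ℤ) :
    (Function.support fun i : ℤ => i * min (i - k) 0 - (i - k) * min i 0).Finite :=
  (Set.finite_Ico (-|k|) |k|).subset fun i hi => by_contra fun h => hi (cocycle_term k i h)

theorem cocycle_sum_aux (n : ℤ) (m : ℕ) :
    6 * ∑ j ∈ Finset.range m, (j : ℤ) * (j - n) = (m - 1) * m * (2 * m - 1) - 3 * n * m * (m - 1) := by
  induction m with
  | zero => simp
  | succ m ih =>
    rw [Finset.sum_range_succ, mul_add, ih]
    push_cast
    ring

theorem cocycle_sum (k : ℤ) :
    6 * ∑ᶠ i : ℤ, (i * min (i - k) 0 - (i - k) * min i 0) = k - k ^ 3 := by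
  obtain ⟨n, rfl | rfl⟩ := k.eq_nat_or_neg
  · rw [finsum_eq_sum_of_support_subset (s := (Finset.range n).map Nat.castEmbedding)]
    · rw [Finset.sum_map]
      have h : ∀ j ∈ Finset.range n, ((Nat.castEmbedding j : ℤ) * min ((Nat.castEmbedding j : ℤ) - n) 0 -
          ((Nat.castEmbedding j : ℤ) - n) * min (Nat.castEmbedding j : ℤ) 0) = (j : ℤ) * (j - n) := by
        intro j hj
        rw [Finset.mem_range] at hj
        rw [Nat.castEmbedding_apply, min_eq_left (by omega), min_eq_right (by omega)]
        ring
      rw [Finset.sum_congr rfl h, cocycle_sum_aux]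
      ring
    · intro i hi
      by_contra hc
      refine hi ?_
      have hc' : ¬ (0 ≤ i ∧ i < n) := by
        rintro ⟨h1, h2⟩
        refine hc ?_
        lift i to ℕ using h1
        simpa using h2
      change i * min (i - n) 0 - (i - n) * min i 0 = 0
      by_cases h : (n : ℤ) ≤ i
      · rw [min_eq_right (by omega), min_eq_right (by omega)]; ring
      · rw [min_eq_left (by omega), min_eq_left (by omega)]; ring
  · rw [← finsum_comp_equiv (Equiv.neg ℤ),
      finsum_eq_sum_of_support_subset (s := (Finset.range n).map Nat.castEmbedding)]
    · rw [Finset.sum_map]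
      have h : ∀ j ∈ Finset.range n, ((Equiv.neg ℤ (Nat.castEmbedding j : ℤ)) *
          min ((Equiv.neg ℤ (Nat.castEmbedding j : ℤ)) - (-n : ℤ)) 0 -
          ((Equiv.neg ℤ (Nat.castEmbedding j : ℤ)) - (-n : ℤ)) *
            min (Equiv.neg ℤ (Nat.castEmbedding j : ℤ)) 0) = -((j : ℤ) * (j - n)) := by
        intro j hj
        rw [Finset.mem_range] at hj
        rw [Nat.castEmbedding_apply, Equiv.neg_apply, min_eq_right (by omega),
          min_eq_left (by omega)]
        ring
      rw [Finset.sum_congr rfl h, Finset.sum_neg_distrib, mul_neg, cocycle_sum_aux]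
      ring
    · intro i hi
      by_contra hc
      refine hi ?_
      have hc' : ¬ (0 ≤ i ∧ i < n) := by
        rintro ⟨h1, h2⟩
        refine hc ?_
        lift i to ℕ using h1
        simpa using h2
      change (-i) * min (-i - -n) 0 - (-i - -n) * min (-i) 0 = 0
      by_cases h : (n : ℤ) ≤ i
      · rw [min_eq_left (by omega), min_eq_left (by omega)]; ring
      · rw [min_eq_right (by omega), min_eq_right (by omega)]; ring

theorem IsChargedSimple.sumOp_sumOp (hH : IsChargedSimple H) (k l : ℤ) (v : H) :
    hH.sumOp k (hH.sumOp l v) = hH.sumOp l (hH.sumOp k v) -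
      (2 * hH.level * (l - k)) • hH.sumOp (l + k) v +
      (if k = -l then ((k : ℂ) ^ 3 - k) / 3 * hH.level ^ 2 else 0) • v := by
  have e0 : hH.sumOp k (hH.sumOp l v) =
      ∑ᶠ i : ℤ, hH.sumOp k (normalOrder H (-i) (i + l) v) :=
    (hH.sumOp k).toAddMonoidHom.map_finsum (hH.support_finite l v)
  have hf0 : Function.HasFiniteSupport fun i : ℤ => hH.sumOp k (normalOrder H (-i) (i + l) v) :=
    (hH.support_finite l v).subset fun i hi hi' => hi (by simp [hi'])
  have e1 : hH.sumOp l (hH.sumOp k v) = ∑ᶠ i : ℤ, normalOrder H (-i) (i + l) (hH.sumOp k v) := rfl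
  have e2 : hH.sumOp k (hH.sumOp l v) - hH.sumOp l (hH.sumOp k v) =
      ∑ᶠ i : ℤ, (hH.sumOp k (normalOrder H (-i) (i + l) v) -
        normalOrder H (-i) (i + l) (hH.sumOp k v)) := by
    rw [e0, e1, finsum_sub_distrib hf0 (hH.support_finite l _)]
  let G : ℤ → H := fun i => normalOrder H (-i) (i + (l + k)) v
  have hG : (Function.support G).Finite := hH.support_finite (l + k) v
  let φ : ℤ →+ H :=
    ((LinearMap.toSpanSingleton ℂ H
      ((if k = -l then -2 * hH.level ^ 2 else 0 : ℂ) • v)).toAddMonoidHom).comp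
      (Int.castAddHom ℂ)
  have hφ (z : ℤ) : φ z = (z : ℂ) • (if k = -l then -2 * hH.level ^ 2 else 0 : ℂ) • v := rfl
  have e3 (i : ℤ) : hH.sumOp k (normalOrder H (-i) (i + l) v) -
        normalOrder H (-i) (i + l) (hH.sumOp k v) =
      ((2 * hH.level * i) • G (i - k) - (2 * hH.level * (i + l)) • G i) +
        φ (i * min (i - k) 0 - (i - k) * min i 0) := by
    have g1 : G (i - k) = opI H (-i + k) (opI H (i + l) v) +
        (if k = -l then (min (i - k) 0 : ℤ) * hH.level else 0) • v := by
      simp only [G]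
      rw [hH.normalOrder_apply, show -(i - k) = -i + k by ring,
        show i - k + (l + k) = i + l by ring]
      simp only [show l + k = 0 ↔ k = -l by omega]
    have g2 : G i = opI H (-i) (opI H (i + l + k) v) +
        (if k = -l then (min i 0 : ℤ) * hH.level else 0) • v := by
      simp only [G]
      rw [hH.normalOrder_apply, show i + (l + k) = i + l + k by ring]
      simp only [show l + k = 0 ↔ k = -l by omega]
    rw [g1, g2, hφ, hH.normalOrder_apply, hH.normalOrder_apply, map_add, map_smul,
      hH.sumOp_opI, hH.sumOp_opI, map_sub, map_smul]
    push_cast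
    by_cases hk : k = -l
    · simp only [if_pos hk]
      subst hk
      push_cast
      module
    · simp only [if_neg hk]
      module
  have hs1 : Function.HasFiniteSupport fun i : ℤ => (2 * hH.level * i) • G (i - k) := by
    refine (hG.image (· + k)).subset fun i hi => ⟨i - k, fun h => hi ?_, by simp⟩
    simp [h]
  have hs2 : Function.HasFiniteSupport fun i : ℤ => (2 * hH.level * (i + l)) • G i :=
    hG.subset fun i hi h => hi (by simp [h])
  have hs2' : Function.HasFiniteSupport fun i : ℤ => (2 * hH.level * (i + k)) • G i :=
    hG.subset fun i hi h => hi (by simp [h])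
  have hs12 : Function.HasFiniteSupport fun i : ℤ =>
      (2 * hH.level * i) • G (i - k) - (2 * hH.level * (i + l)) • G i :=
    (hs1.union hs2).subset (Function.support_sub _ _)
  have hs3 : Function.HasFiniteSupport fun i : ℤ =>
      φ (i * min (i - k) 0 - (i - k) * min i 0) :=
    (cocycle_support k).subset fun i hi h => hi (by
      change φ _ = 0
      exact (congrArg φ h).trans (map_zero φ))
  have e4 : ∑ᶠ i : ℤ, (2 * hH.level * i) • G (i - k) =
      ∑ᶠ i : ℤ, (2 * hH.level * (i + k)) • G i := by
    rw [← finsum_comp_equiv (Equiv.addRight k)]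
    refine finsum_congr fun i => ?_
    simp
  have e5 : ∑ᶠ i : ℤ, (2 * hH.level * (i + k)) • G i - ∑ᶠ i : ℤ, (2 * hH.level * (i + l)) • G i =
      -((2 * hH.level * (l - k)) • hH.sumOp (l + k) v) := by
    change _ = -((2 * hH.level * (l - k)) • ∑ᶠ i : ℤ, G i)
    rw [← finsum_sub_distrib hs2' hs2, smul_finsum, ← finsum_neg_distrib]
    refine finsum_congr fun i => ?_
    module
  have e6 : ∑ᶠ i : ℤ, φ (i * min (i - k) 0 - (i - k) * min i 0) =
      (if k = -l then ((k : ℂ) ^ 3 - k) / 3 * hH.level ^ 2 else 0) • v := by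
    rw [← φ.map_finsum (cocycle_support k), hφ]
    have h := congrArg (Int.cast : ℤ → ℂ) (cocycle_sum k)
    push_cast at h
    rw [smul_smul]
    congr 1
    split_ifs
    · linear_combination (-hH.level ^ 2 / 3) * h
    · ring
  rw [finsum_congr e3, finsum_add_distrib hs12 hs3, finsum_sub_distrib hs1 hs2, e4, e5, e6,
    sub_eq_iff_eq_add'] at e2
  rw [e2]
  abel

/-- The operators of the oscillator representation. -/
def IsChargedSimple.oscLin (hH : IsChargedSimple H) (lam : ℂ) : LL →ₗ[ℂ] Module.End ℂ H :=
  basis.constr ℂ fun g =>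
    match g with
    | .d k => hH.opD lam k
    | .I k => opI H k
    | .z1 => (1 - 12 * lam ^ 2 / hH.level) • 1
    | .z2 => lam • 1
    | .z3 => hH.level • 1

section

variable (hH : IsChargedSimple H) (lam : ℂ)

theorem IsChargedSimple.oscLin_d (k : ℤ) : hH.oscLin lam (gen (.d k)) = hH.opD lam k := by
  simp [oscLin, gen]

theorem IsChargedSimple.oscLin_I (k : ℤ) : hH.oscLin lam (gen (.I k)) = opI H k := by
  simp [oscLin, gen]

theorem IsChargedSimple.oscLin_z1 :
    hH.oscLin lam (gen .z1) = (1 - 12 * lam ^ 2 / hH.level) • 1 := by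
  simp [oscLin, gen]

theorem IsChargedSimple.oscLin_z2 : hH.oscLin lam (gen .z2) = lam • 1 := by
  simp [oscLin, gen]

theorem IsChargedSimple.oscLin_z3 : hH.oscLin lam (gen .z3) = hH.level • 1 := by
  simp [oscLin, gen]

theorem IsChargedSimple.opD_apply (k : ℤ) (v : H) : hH.opD lam k v =
    (-(1 / (2 * hH.level))) • hH.sumOp k v + (((k : ℂ) + 1) * lam / hH.level) • opI H k v := rfl

theorem IsChargedSimple.oscLin_d_I (n m : ℤ) : ⁅hH.opD lam n, opI H m⁆ =
    (m : ℂ) • opI H (m + n) + (if n = -m then (n : ℂ) ^ 2 + n else 0) • lam • 1 := by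
  have hc := hH.level_ne_zero
  ext v
  simp only [Ring.lie_def, LinearMap.sub_apply, Module.End.mul_apply, LinearMap.add_apply,
    LinearMap.smul_apply, Module.End.one_apply, hH.opD_apply, map_add, map_smul,
    hH.sumOp_opI, hH.opI_comm n m]
  by_cases h : n = -m
  · simp only [if_pos h]
    have hm : (m : ℂ) = -n := by rw [h]; push_cast; ring
    rw [hm]
    match_scalars <;> field_simp <;> ring
  · simp only [if_neg h]
    match_scalars <;> field_simp <;> ring

theorem IsChargedSimple.oscLin_d_d (n m : ℤ) : ⁅hH.opD lam n, hH.opD lam m⁆ =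
    ((m : ℂ) - n) • hH.opD lam (m + n) +
      (if n = -m then ((n : ℂ) ^ 3 - n) / 12 else 0) • (1 - 12 * lam ^ 2 / hH.level) • 1 := by
  have hc := hH.level_ne_zero
  ext v
  simp only [Ring.lie_def, LinearMap.sub_apply, Module.End.mul_apply, LinearMap.add_apply,
    LinearMap.smul_apply, Module.End.one_apply, hH.opD_apply, map_add, map_smul,
    hH.sumOp_opI, hH.opI_comm n m, hH.sumOp_sumOp n m]
  rw [add_comm n m]
  by_cases h : n = -m
  · simp only [if_pos h]
    have hm : (m : ℂ) = -n := by rw [h]; push_cast; ring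
    push_cast
    rw [hm]
    match_scalars <;> field_simp <;> ring
  · simp only [if_neg h]
    match_scalars <;> field_simp <;> ring

theorem IsChargedSimple.oscLin_I_I (n m : ℤ) : ⁅opI H n, opI H m⁆ =
    (if n = -m then (n : ℂ) else 0) • hH.level • 1 := by
  ext v
  simp only [Ring.lie_def, LinearMap.sub_apply, Module.End.mul_apply,
    LinearMap.smul_apply, Module.End.one_apply, hH.opI_comm n m]
  rw [add_sub_cancel_left, smul_smul, ite_mul, zero_mul]

end

/-- The operators of the oscillator representation respect the brackets. -/
theorem IsChargedSimple.oscLin_lie (hH : IsChargedSimple H) (lam : ℂ) (x y : LL) :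
    hH.oscLin lam ⁅x, y⁆ = hH.oscLin lam x * hH.oscLin lam y -
      hH.oscLin lam y * hH.oscLin lam x := by
  induction x using gen_induction with
  | hgen g =>
    induction y using gen_induction with
    | hgen h =>
      rw [lie_gen]
      rcases g with n | n | _ | _ | _ <;> rcases h with m | m | _ | _ | _ <;>
        simp only [genBracket, map_add, map_neg, map_smul, map_zero, hH.oscLin_d, hH.oscLin_I,
          hH.oscLin_z1, hH.oscLin_z2, hH.oscLin_z3, mul_smul_comm, smul_mul_assoc, mul_one,
          one_mul, sub_self]
      · rw [← Ring.lie_def, hH.oscLin_d_d]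
      · rw [← Ring.lie_def, hH.oscLin_d_I]
      · rw [← hH.oscLin_d_I, Ring.lie_def, neg_sub]
      · rw [← Ring.lie_def, hH.oscLin_I_I]
      all_goals rw [smul_comm, sub_self]
    | hadd y z h1 h2 => simp only [lie_add, map_add, h1, h2, mul_add, add_mul]; abel
    | hsmul c y h1 =>
      simp only [lie_smul, map_smul, h1, mul_smul_comm, smul_mul_assoc, smul_sub]
  | hadd y z h1 h2 => simp only [add_lie, map_add, h1, h2, mul_add, add_mul]; abel
  | hsmul c y h1 => simp only [smul_lie, map_smul, h1, mul_smul_comm, smul_mul_assoc, smul_sub]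

theorem IsChargedSimple.oscLin_lie_apply (hH : IsChargedSimple H) (lam : ℂ) (x y : LL) (v : H) :
    hH.oscLin lam x (hH.oscLin lam y v) =
      hH.oscLin lam ⁅x, y⁆ v + hH.oscLin lam y (hH.oscLin lam x v) := by
  rw [hH.oscLin_lie, LinearMap.sub_apply, Module.End.mul_apply, Module.End.mul_apply,
    sub_add_cancel]

/-- The generalized oscillator representation `H(lam)`: the space `H` with `I k` and `z3` acting as
before, `z2` acting as `lam`, `z1` as `1 - 12 lam ^ 2 / c` and `d k` as
`-(1 / (2 c)) ∑ i, :I_{-i} I_{i+k}: + ((k + 1) lam / c) I_k`, where `z3` acts as the scalar `c`. -/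
def Osc (_hH : IsChargedSimple H) (_lam : ℂ) : Type _ := H

section

variable (hH : IsChargedSimple H) (lam : ℂ)

instance : AddCommGroup (Osc hH lam) := inferInstanceAs (AddCommGroup H)
instance : Module ℂ (Osc hH lam) := inferInstanceAs (Module ℂ H)

instance : LieRingModule LL (Osc hH lam) where
  bracket x v := hH.oscLin lam x v
  add_lie x y v := LinearMap.congr_fun (map_add (hH.oscLin lam) x y) v
  lie_add x v w := map_add (hH.oscLin lam x) v w
  leibniz_lie x y v := hH.oscLin_lie_apply lam x y v

instance : LieModule ℂ LL (Osc hH lam) where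
  smul_lie c x v := LinearMap.congr_fun (map_smul (hH.oscLin lam) c x) v
  lie_smul c x v := map_smul (hH.oscLin lam x) c v

theorem Osc.heis_lie (x : Heis) (v : H) :
    (⁅(x : LL), (v : Osc hH lam)⁆ : Osc hH lam) = (⁅x, v⁆ : H) := by
  change hH.oscLin lam (x : LL) v = ⁅x, v⁆
  have hx : x ∈ Submodule.span ℂ (Set.range Heis.I ∪ {Heis.z3}) :=
    Heis.span_eq_top ▸ Submodule.mem_top
  induction hx using Submodule.span_induction with
  | mem x h =>
    rcases h with ⟨n, rfl⟩ | rfl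
    · exact LinearMap.congr_fun (hH.oscLin_I lam n) v
    · exact (LinearMap.congr_fun (hH.oscLin_z3 lam) v).trans (hH.z3_lie v).symm
  | zero =>
    rw [zero_lie]
    exact LinearMap.congr_fun (map_zero (hH.oscLin lam)) v
  | add x y _ _ h1 h2 =>
    rw [add_lie, ← h1, ← h2]
    exact LinearMap.congr_fun (map_add (hH.oscLin lam) (x : LL) y) v
  | smul c x _ h1 =>
    rw [smul_lie, ← h1]
    exact LinearMap.congr_fun (map_smul (hH.oscLin lam) c (x : LL)) v

end

end Oscillator

end HeisVir

end

open scoped TensorProduct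

/-!
The Heisenberg algebra kills the factor `V` of `V ⊗ H(lam)`, so it acts there through `H` alone. By
Schur's lemma the endomorphisms of the simple `Heis`-module `H` are the scalars, hence by the
Jacobson density theorem every linear operator `f` on `H` agrees on any finite set with an operator
from the associative algebra generated by `Heis`
(`LieModule.IsIrreducible.exists_mem_adjoin_eqOn`). A tensor involves finitely many vectors of `H`
only, which gives two consequences: a submodule of `V ⊗ H(lam)` is stable under all `id ⊗ f`
(`LieModule.IsIrreducible.lTensor_mem`), and an isomorphism `V ⊗ H(lam) ≃ W ⊗ H(lam)` commutes with
all `id ⊗ f` (`LieModule.IsIrreducible.map_lTensor`). Both are used with the rank one operators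
`f = φ(·) m`, for which `id ⊗ f` sends `t` to `v ⊗ m`, where `v` is the contraction of `t` with `φ`.

For a submodule `N` of `V ⊗ H(lam)`, let `V'` be the space of all `v` with `v ⊗ H ⊆ N`. It contains
all contractions of elements of `N`, so `N = V' ⊗ H`; and it is stable under the Virasoro algebra,
because `x v ⊗ h = x (v ⊗ h) - v ⊗ x h`. Thus `V' ↦ V' ⊗ H(lam)` is an isomorphism between the
lattices of submodules (`HeisVir.tensorSubmoduleOrderIso`), which also settles simplicity.

For an isomorphism `Φ : V ⊗ H(lam) ≃ W ⊗ K(mu)`, comparing the actions of `z2` gives `lam = mu`, and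
contracting `Φ (v ⊗ ·)` with a functional on `W` gives a nonzero homomorphism `H → K` of simple
`Heis`-modules. Since the action of the whole algebra on `H(lam)` is written in terms of that of
`Heis`, the resulting isomorphism `H ≃ K` is also one of `H(lam)` with `K(lam)`, so `K = H` may be
assumed. Then `Φ = g ⊗ id` for a linear map `g : V → W` (`HeisVir.exists_linearMap_tmul`), and `g`
is an isomorphism of `Vir`-modules.
-/

open scoped TensorProduct

noncomputable section

/-! ### The density theorem for simple modules over a Lie algebra -/

section Density

variable {L M : Type*} [LieRing L] [LieAlgebra ℂ L] [AddCommGroup M] [Module ℂ M]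
  [LieRingModule L M] [LieModule ℂ L M]

/-- A simple module over a Lie algebra is simple over the associative algebra generated by the
action. -/
theorem LieModule.IsIrreducible.isSimpleModule_adjoin (hM : LieModule.IsIrreducible ℂ L M) :
    IsSimpleModule (Algebra.adjoin ℂ (Set.range (LieModule.toEnd ℂ L M))) M := by
  have := (LieSubmodule.nontrivial_iff ℂ L M).mp hM.toNontrivial
  refine { exists_pair_ne := ⟨⊥, ⊤, bot_ne_top⟩, eq_bot_or_eq_top := fun P => ?_ }
  let N : LieSubmodule ℂ L M :=
    { P.restrictScalars ℂ with
      lie_mem := fun {x m} hm =>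
        P.smul_mem ⟨LieModule.toEnd ℂ L M x, Algebra.subset_adjoin ⟨x, rfl⟩⟩ hm }
  have hN (m : M) : m ∈ N ↔ m ∈ P := Iff.rfl
  refine (hM.eq_bot_or_eq_top N).imp (fun h => ?_) (fun h => ?_)
  · ext m
    rw [← hN, h, LieSubmodule.mem_bot, Submodule.mem_bot]
  · ext m
    simp [← hN, h]

/-- The density theorem: every linear operator on a simple module agrees on any finite set with an
operator from the associative algebra generated by the action, since by Schur's lemma the scalars
are the only endomorphisms. -/
theorem LieModule.IsIrreducible.exists_mem_adjoin_eqOn (hM : LieModule.IsIrreducible ℂ L M)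
    {s : Set L} (hs : s.Countable) (hspan : Submodule.span ℂ s = ⊤) (f : Module.End ℂ M)
    (t : Finset M) :
    ∃ a ∈ Algebra.adjoin ℂ (Set.range (LieModule.toEnd ℂ L M)), ∀ m ∈ t, a m = f m := by
  set A := Algebra.adjoin ℂ (Set.range (LieModule.toEnd ℂ L M))
  have := hM.isSimpleModule_adjoin
  let F : Module.End (Module.End A M) M :=
    { toFun := f
      map_add' := map_add f
      map_smul' := by
        intro e m
        let e' : M →ₗ⁅ℂ,L⁆ M :=
          { e.restrictScalars ℂ with
            map_lie' := fun {x m} =>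
              e.map_smul ⟨LieModule.toEnd ℂ L M x, Algebra.subset_adjoin ⟨x, rfl⟩⟩ m }
        obtain ⟨c, hc⟩ := HeisVir.exists_scalar hM hs hspan e'
        have hc' (m : M) : e m = c • m := hc m
        simp [hc'] }
  obtain ⟨a, ha⟩ := jacobson_density F t
  exact ⟨a, a.2, fun m hm => (ha m hm).symm⟩

variable {V W : Type*} [AddCommGroup V] [Module ℂ V] [AddCommGroup W] [Module ℂ W]

/-- The effect of `id ⊗ f` on a given tensor depends only on finitely many values of `f`. -/
theorem TensorProduct.exists_finset_lTensor_congr {M : Type*} [AddCommGroup M] [Module ℂ M]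
    (t : V ⊗[ℂ] M) : ∃ s : Finset M, ∀ f g : Module.End ℂ M, (∀ m ∈ s, f m = g m) →
      f.lTensor V t = g.lTensor V t := by
  classical
  induction t with
  | zero => exact ⟨∅, fun f g _ => by simp⟩
  | tmul v m => exact ⟨{m}, fun f g h => by simp [h m (by simp)]⟩
  | add t u ht hu =>
    obtain ⟨s, hs⟩ := ht
    obtain ⟨s', hs'⟩ := hu
    refine ⟨s ∪ s', fun f g h => ?_⟩
    rw [map_add, map_add, hs f g fun m hm => h m (Finset.mem_union_left _ hm),
      hs' f g fun m hm => h m (Finset.mem_union_right _ hm)]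

/-- A subspace of `V ⊗ M` stable under the action of `L` on the simple factor `M` is stable under
all operators `id ⊗ f`. -/
theorem LieModule.IsIrreducible.lTensor_mem (hM : LieModule.IsIrreducible ℂ L M)
    {s : Set L} (hs : s.Countable) (hspan : Submodule.span ℂ s = ⊤) {N : Submodule ℂ (V ⊗[ℂ] M)}
    (hN : ∀ x : L, ∀ t ∈ N, (LieModule.toEnd ℂ L M x).lTensor V t ∈ N)
    (f : Module.End ℂ M) {t : V ⊗[ℂ] M} (ht : t ∈ N) : f.lTensor V t ∈ N := by
  obtain ⟨u, hu⟩ := TensorProduct.exists_finset_lTensor_congr t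
  obtain ⟨a, ha, hau⟩ := hM.exists_mem_adjoin_eqOn hs hspan f u
  rw [← hu a f hau]
  clear hau hu u
  induction ha using Algebra.adjoin_induction generalizing t with
  | mem a h =>
    obtain ⟨x, rfl⟩ := h
    exact hN x t ht
  | algebraMap c =>
    rw [Algebra.algebraMap_eq_smul_one, LinearMap.lTensor_smul, LinearMap.smul_apply,
      Module.End.one_eq_id, LinearMap.lTensor_id_apply]
    exact N.smul_mem c ht
  | add a b _ _ h1 h2 =>
    rw [LinearMap.lTensor_add, LinearMap.add_apply]
    exact N.add_mem (h1 ht) (h2 ht)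
  | mul a b _ _ h1 h2 =>
    rw [LinearMap.lTensor_mul, Module.End.mul_apply]
    exact h1 (h2 ht)

/-- A linear map `V ⊗ M → W ⊗ M` commuting with the action of `L` on the simple factor `M` commutes
with all operators `id ⊗ f`. -/
theorem LieModule.IsIrreducible.map_lTensor (hM : LieModule.IsIrreducible ℂ L M)
    {s : Set L} (hs : s.Countable) (hspan : Submodule.span ℂ s = ⊤)
    (Φ : V ⊗[ℂ] M →ₗ[ℂ] W ⊗[ℂ] M)
    (hΦ : ∀ (x : L) (t : V ⊗[ℂ] M), Φ ((LieModule.toEnd ℂ L M x).lTensor V t) =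
      (LieModule.toEnd ℂ L M x).lTensor W (Φ t))
    (f : Module.End ℂ M) (t : V ⊗[ℂ] M) : Φ (f.lTensor V t) = f.lTensor W (Φ t) := by
  classical
  obtain ⟨u, hu⟩ := TensorProduct.exists_finset_lTensor_congr t
  obtain ⟨u', hu'⟩ := TensorProduct.exists_finset_lTensor_congr (Φ t)
  obtain ⟨a, ha, hau⟩ := hM.exists_mem_adjoin_eqOn hs hspan f (u ∪ u')
  rw [← hu a f fun m hm => hau m (Finset.mem_union_left _ hm),
    ← hu' a f fun m hm => hau m (Finset.mem_union_right _ hm)]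
  clear hau hu hu' u u'
  induction ha using Algebra.adjoin_induction generalizing t with
  | mem a h =>
    obtain ⟨x, rfl⟩ := h
    exact hΦ x t
  | algebraMap c =>
    simp [Algebra.algebraMap_eq_smul_one, LinearMap.lTensor_smul, Module.End.one_eq_id]
  | add a b _ _ h1 h2 => simp [LinearMap.lTensor_add, h1, h2]
  | mul a b _ _ h1 h2 => simp [LinearMap.lTensor_mul, h1, h2]

end Density

/-! ### Contractions of tensors -/

section Contraction

variable {V M : Type*} [AddCommGroup V] [Module ℂ V] [AddCommGroup M] [Module ℂ M]

/-- The contraction `V ⊗ M → V` with a functional on `M`. -/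
def TensorProduct.contractSnd (V : Type*) [AddCommGroup V] [Module ℂ V]
    (φ : Module.Dual ℂ M) : V ⊗[ℂ] M →ₗ[ℂ] V :=
  (TensorProduct.rid ℂ V).toLinearMap ∘ₗ φ.lTensor V

@[simp]
theorem TensorProduct.contractSnd_tmul (φ : Module.Dual ℂ M) (v : V) (m : M) :
    TensorProduct.contractSnd V φ (v ⊗ₜ m) = φ m • v := by
  simp [contractSnd]

theorem TensorProduct.lTensor_smulRight (φ : Module.Dual ℂ M) (m : M) (t : V ⊗[ℂ] M) :
    (φ.smulRight m).lTensor V t = TensorProduct.contractSnd V φ t ⊗ₜ m := by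
  induction t with
  | zero => simp
  | tmul v n => simp [TensorProduct.smul_tmul]
  | add t u ht hu => rw [map_add, map_add, ht, hu, TensorProduct.add_tmul]

theorem TensorProduct.tmul_left_injective {m : M} (hm : m ≠ 0) :
    Function.Injective fun v : V => v ⊗ₜ[ℂ] m := by
  obtain ⟨φ, hφ⟩ := Module.Projective.exists_dual_eq_one ℂ hm
  intro v w h
  simpa [hφ] using congrArg (TensorProduct.contractSnd V φ) h

/-- A tensor is a sum of elements `v ⊗ m` whose left factors are contractions of that tensor. -/
theorem TensorProduct.mem_of_forall_contractSnd_tmul_mem {N : Submodule ℂ (V ⊗[ℂ] M)}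
    {t : V ⊗[ℂ] M}
    (h : ∀ (φ : Module.Dual ℂ M) (m : M), TensorProduct.contractSnd V φ t ⊗ₜ m ∈ N) : t ∈ N := by
  classical
  let b := Module.Basis.ofVectorSpace ℂ M
  have ht := (TensorProduct.equivFinsuppOfBasisRight (M := V) b).symm_apply_apply t
  rw [TensorProduct.equivFinsuppOfBasisRight_symm_apply] at ht
  rw [← ht]
  refine N.sum_mem fun i _ => ?_
  rw [TensorProduct.equivFinsuppOfBasisRight_apply]
  exact h _ _

/-- The contraction `V ⊗ M → M` with a functional on `V`. -/
def TensorProduct.contractFst (M : Type*) [AddCommGroup M] [Module ℂ M]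
    (φ : Module.Dual ℂ V) : V ⊗[ℂ] M →ₗ[ℂ] M :=
  (TensorProduct.lid ℂ M).toLinearMap ∘ₗ φ.rTensor M

@[simp]
theorem TensorProduct.contractFst_tmul (φ : Module.Dual ℂ V) (v : V) (m : M) :
    TensorProduct.contractFst M φ (v ⊗ₜ m) = φ v • m := by
  simp [contractFst]

theorem TensorProduct.contractFst_lTensor (φ : Module.Dual ℂ V) (f : Module.End ℂ M)
    (t : V ⊗[ℂ] M) : TensorProduct.contractFst M φ (f.lTensor V t) =
      f (TensorProduct.contractFst M φ t) := by
  induction t with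
  | zero => simp
  | tmul v m => simp
  | add t u ht hu => simp only [map_add, ht, hu]

theorem TensorProduct.exists_contractFst_ne_zero {t : V ⊗[ℂ] M} (ht : t ≠ 0) :
    ∃ φ : Module.Dual ℂ V, TensorProduct.contractFst M φ t ≠ 0 := by
  classical
  by_contra! h
  let b := Module.Basis.ofVectorSpace ℂ V
  refine ht ((TensorProduct.equivFinsuppOfBasisLeft (N := M) b).injective ?_)
  ext i
  rw [TensorProduct.equivFinsuppOfBasisLeft_apply, map_zero]
  exact h (b.coord i)

end Contraction

/-! ### Equivalences of modules over a Lie algebra -/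

section LieModuleEquiv

variable {R L : Type*} [CommRing R] [LieRing L] [LieAlgebra R L]
  {M N P Q : Type*} [AddCommGroup M] [Module R M] [LieRingModule L M] [LieModule R L M]
  [AddCommGroup N] [Module R N] [LieRingModule L N] [LieModule R L N]
  [AddCommGroup P] [Module R P] [LieRingModule L P] [LieModule R L P]
  [AddCommGroup Q] [Module R Q] [LieRingModule L Q] [LieModule R L Q]

/-- A linear equivalence respecting the action of a Lie algebra, as an equivalence of modules. -/
def LieModuleEquiv.ofLinearEquiv (e : M ≃ₗ[R] N) (he : ∀ (x : L) (m : M), e ⁅x, m⁆ = ⁅x, e m⁆) :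
    M ≃ₗ⁅R,L⁆ N :=
  { e with map_lie' := he _ _ }

/-- The tensor product of two equivalences of modules over a Lie algebra. -/
def TensorProduct.LieModule.congr (e : M ≃ₗ⁅R,L⁆ P) (f : N ≃ₗ⁅R,L⁆ Q) :
    M ⊗[R] N ≃ₗ⁅R,L⁆ P ⊗[R] Q :=
  LieModuleEquiv.ofLinearEquiv (TensorProduct.congr e.toLinearEquiv f.toLinearEquiv)
    (TensorProduct.LieModule.map (e : M →ₗ⁅R,L⁆ P) (f : N →ₗ⁅R,L⁆ Q)).map_lie

omit [LieAlgebra R L] [LieModule R L M] [LieModule R L N] in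
/-- A nonzero homomorphism between simple modules is an isomorphism. -/
theorem LieModuleHom.nonempty_equiv_of_isIrreducible (hM : LieModule.IsIrreducible R L M)
    (hN : LieModule.IsIrreducible R L N) (f : M →ₗ⁅R,L⁆ N) {m : M} (hf : f m ≠ 0) :
    Nonempty (M ≃ₗ⁅R,L⁆ N) := by
  have hker : f.ker = ⊥ := (hM.eq_bot_or_eq_top f.ker).resolve_right fun h =>
    hf (f.mem_ker.mp (h ▸ LieSubmodule.mem_top m))
  have hran : f.range = ⊤ := (hN.eq_bot_or_eq_top f.range).resolve_left fun h => by
    have h1 : f m ∈ f.range := ⟨m, rfl⟩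
    rw [h, LieSubmodule.mem_bot] at h1
    exact hf h1
  exact ⟨.ofLinearEquiv (LinearEquiv.ofBijective (f : M →ₗ[R] N)
    ⟨f.ker_eq_bot.mp hker, f.range_eq_top.mp hran⟩) f.map_lie⟩

end LieModuleEquiv

namespace HeisVir

/-! ### The tensor product of an inflation and an oscillator representation -/

theorem Heis.countable_generators : (Set.range Heis.I ∪ {Heis.z3}).Countable :=
  (Set.countable_range _).union (Set.countable_singleton _)

theorem proj_heis (x : Heis) : proj (x : LL) = 0 := by
  have hx : x ∈ Submodule.span ℂ (Set.range Heis.I ∪ {Heis.z3}) :=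
    Heis.span_eq_top ▸ Submodule.mem_top
  induction hx using Submodule.span_induction with
  | mem x h =>
    rcases h with ⟨n, rfl⟩ | rfl
    · exact projLin_I n
    · exact projLin_z3
  | zero => exact map_zero proj
  | add x y _ _ h1 h2 => exact (map_add proj (x : LL) y).trans (by rw [h1, h2, add_zero])
  | smul c x _ h1 => exact (map_smul proj c (x : LL)).trans (by rw [h1, smul_zero])

section Basic

variable {V H : Type*}
  [AddCommGroup V] [Module ℂ V] [LieRingModule Vir V] [LieModule ℂ Vir V]
  [AddCommGroup H] [Module ℂ H] [LieRingModule Heis H] [LieModule ℂ Heis H]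
  (hH : IsChargedSimple H) (lam : ℂ)

variable (V) in
/-- The identity map from `V` to its inflation; it keeps the two module structures apart. -/
def Inflation.of : V ≃ₗ[ℂ] Inflation V := LinearEquiv.refl ℂ V

/-- The identity map from `H` to `H(lam)`; it keeps the two module structures apart. -/
def Osc.of : H ≃ₗ[ℂ] Osc hH lam := LinearEquiv.refl ℂ H

omit [LieModule ℂ Vir V] in
theorem Inflation.lie_of (x : LL) (v : V) :
    ⁅x, Inflation.of V v⁆ = Inflation.of V ⁅proj x, v⁆ := rfl

omit [LieModule ℂ Vir V] in
theorem Inflation.lie_eq_zero {x : LL} (hx : proj x = 0) (v : Inflation V) : ⁅x, v⁆ = 0 := by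
  obtain ⟨v, rfl⟩ := (Inflation.of V).surjective v
  rw [Inflation.lie_of, hx, zero_lie, map_zero]

theorem Osc.heis_lie_of (x : Heis) (v : H) :
    ⁅(x : LL), Osc.of hH lam v⁆ = Osc.of hH lam ⁅x, v⁆ := Osc.heis_lie hH lam x v

omit [LieModule ℂ Heis H] in
include hH in
theorem IsChargedSimple.nontrivial : Nontrivial H :=
  (LieSubmodule.nontrivial_iff ℂ Heis H).mp hH.simple.toNontrivial

instance Osc.nontrivial : Nontrivial (Osc hH lam) := hH.nontrivial

/-- `H(lam)` is simple already over the Heisenberg subalgebra, to which the action is restricted. -/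
theorem Osc.isIrreducible_heis : LieModule.IsIrreducible ℂ Heis (Osc hH lam) := by
  have := hH.nontrivial
  refine LieModule.IsIrreducible.mk fun N hN => ?_
  let N' : LieSubmodule ℂ Heis H :=
    { N.toSubmodule.comap (Osc.of hH lam).toLinearMap with
      lie_mem := fun {x m} hm => by
        have h : ⁅x, Osc.of hH lam m⁆ ∈ N := N.lie_mem hm
        rwa [LieSubalgebra.coe_bracket_of_module, Osc.heis_lie_of] at h }
  have hN' (m : H) : m ∈ N' ↔ Osc.of hH lam m ∈ N := Iff.rfl
  rw [eq_top_iff]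
  intro m _
  obtain ⟨m, rfl⟩ := (Osc.of hH lam).surjective m
  rw [← hN', (hH.simple.eq_bot_or_eq_top N').resolve_left fun h => hN ?_]
  · exact LieSubmodule.mem_top _
  · rw [LieSubmodule.eq_bot_iff]
    intro m hm
    obtain ⟨m, rfl⟩ := (Osc.of hH lam).surjective m
    rw [← hN', h, LieSubmodule.mem_bot] at hm
    rw [hm, map_zero]

theorem z2_lie (t : Inflation V ⊗[ℂ] Osc hH lam) : ⁅gen .z2, t⁆ = lam • t := by
  induction t with
  | zero => simp
  | tmul v h =>
    have h1 : ⁅gen .z2, v⁆ = 0 := Inflation.lie_eq_zero projLin_z2 v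
    have h2 : ⁅gen .z2, h⁆ = lam • h := LinearMap.congr_fun (hH.oscLin_z2 lam) h
    rw [TensorProduct.LieModule.lie_tmul_right, h1, h2, TensorProduct.zero_tmul, zero_add,
      TensorProduct.tmul_smul]
  | add t u ht hu => rw [lie_add, ht, hu, smul_add]

/-- The Heisenberg algebra acts on the second tensor factor only. -/
theorem heis_lie_eq_lTensor (x : Heis) (t : Inflation V ⊗[ℂ] Osc hH lam) :
    ⁅(x : LL), t⁆ = (LieModule.toEnd ℂ Heis (Osc hH lam) x).lTensor (Inflation V) t := by
  induction t with
  | zero => simp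
  | tmul v h =>
    rw [TensorProduct.LieModule.lie_tmul_right, Inflation.lie_eq_zero (proj_heis x),
      TensorProduct.zero_tmul, zero_add]
    rfl
  | add t u ht hu => rw [lie_add, ht, hu, map_add]

theorem vir_lie_tmul (x : Vir) (v : V) (h : Osc hH lam) :
    ⁅(x : LL), Inflation.of V v ⊗ₜ[ℂ] h⁆ =
      Inflation.of V ⁅x, v⁆ ⊗ₜ h + Inflation.of V v ⊗ₜ ⁅(x : LL), h⁆ := by
  rw [TensorProduct.LieModule.lie_tmul_right, Inflation.lie_of, proj_coe]

/-! ### The lattice of submodules of a tensor product -/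

/-- The submodule `V' ⊗ H(lam)` of `V ⊗ H(lam)`. -/
abbrev tensorSubmodule (V' : LieSubmodule ℂ Vir V) :
    LieSubmodule ℂ LL (Inflation V ⊗[ℂ] Osc hH lam) :=
  (TensorProduct.LieModule.map (inflationSubmodule V').incl
    (LieModuleHom.id : Osc hH lam →ₗ⁅ℂ,LL⁆ Osc hH lam)).range

variable {hH lam}

theorem tmul_mem_tensorSubmodule {V' : LieSubmodule ℂ Vir V} {v : V} (hv : v ∈ V')
    (h : Osc hH lam) : Inflation.of V v ⊗ₜ h ∈ tensorSubmodule hH lam V' :=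
  ⟨(⟨v, hv⟩ : inflationSubmodule V') ⊗ₜ h, rfl⟩

theorem contractSnd_mem_of_mem_tensorSubmodule {V' : LieSubmodule ℂ Vir V}
    (φ : Module.Dual ℂ (Osc hH lam)) {t : Inflation V ⊗[ℂ] Osc hH lam}
    (ht : t ∈ tensorSubmodule hH lam V') :
    TensorProduct.contractSnd (Inflation V) φ t ∈ inflationSubmodule V' := by
  obtain ⟨t, rfl⟩ := ht
  induction t with
  | zero => simp
  | tmul v h =>
    change TensorProduct.contractSnd (Inflation V) φ (v.1 ⊗ₜ h) ∈ _
    rw [TensorProduct.contractSnd_tmul]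
    exact (inflationSubmodule V').smul_mem _ v.2
  | add t u ht hu =>
    rw [map_add, map_add]
    exact add_mem ht hu

/-- The vectors `v` of `V` such that `v ⊗ H(lam)` is contained in the submodule `N` of
`V ⊗ H(lam)`. -/
def fiberSubmodule (N : LieSubmodule ℂ LL (Inflation V ⊗[ℂ] Osc hH lam)) :
    LieSubmodule ℂ Vir V where
  carrier := {v | ∀ h : Osc hH lam, Inflation.of V v ⊗ₜ[ℂ] h ∈ N}
  add_mem' {v w} hv hw h := by
    rw [map_add, TensorProduct.add_tmul]
    exact N.add_mem (hv h) (hw h)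
  zero_mem' h := by
    rw [map_zero, TensorProduct.zero_tmul]
    exact N.zero_mem
  smul_mem' c v hv h := by
    rw [map_smul, ← TensorProduct.smul_tmul']
    exact N.smul_mem c (hv h)
  lie_mem {x v} hv h := by
    rw [← add_sub_cancel_right (Inflation.of V ⁅x, v⁆ ⊗ₜ[ℂ] h), ← vir_lie_tmul]
    exact sub_mem (N.lie_mem (hv h)) (hv _)

theorem mem_fiberSubmodule {N : LieSubmodule ℂ LL (Inflation V ⊗[ℂ] Osc hH lam)} {v : V} :
    v ∈ fiberSubmodule N ↔ ∀ h : Osc hH lam, Inflation.of V v ⊗ₜ[ℂ] h ∈ N := Iff.rfl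

theorem fiberSubmodule_tensorSubmodule (V' : LieSubmodule ℂ Vir V) :
    fiberSubmodule (tensorSubmodule hH lam V') = V' := by
  ext v
  refine ⟨fun hv => ?_, fun hv => tmul_mem_tensorSubmodule hv⟩
  obtain ⟨h, hh⟩ := exists_ne (0 : Osc hH lam)
  obtain ⟨φ, hφ⟩ := Module.Projective.exists_dual_eq_one ℂ hh
  have := contractSnd_mem_of_mem_tensorSubmodule φ (mem_fiberSubmodule.mp hv h)
  rwa [TensorProduct.contractSnd_tmul, hφ, one_smul] at this

/-- By density `N` is stable under `id ⊗ f` for every operator `f` on `H`; operators of rank one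
then show that `N` contains `v ⊗ H` for every contraction `v` of an element of `N`. -/
theorem tensorSubmodule_fiberSubmodule (N : LieSubmodule ℂ LL (Inflation V ⊗[ℂ] Osc hH lam)) :
    tensorSubmodule hH lam (fiberSubmodule N) = N := by
  apply le_antisymm
  · rintro _ ⟨t, rfl⟩
    induction t with
    | zero => simp
    | tmul v h => exact v.2 h
    | add t u ht hu =>
      rw [map_add]
      exact add_mem ht hu
  · intro t ht
    refine TensorProduct.mem_of_forall_contractSnd_tmul_mem
      (N := (tensorSubmodule hH lam (fiberSubmodule N)).toSubmodule)
      fun φ m => tmul_mem_tensorSubmodule (mem_fiberSubmodule.mpr fun h => ?_) m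
    refine (TensorProduct.lTensor_smulRight φ h t) ▸
      (Osc.isIrreducible_heis hH lam).lTensor_mem (N := N.toSubmodule) Heis.countable_generators
        Heis.span_eq_top (fun x t ht => ?_) (φ.smulRight h) ht
    rw [← heis_lie_eq_lTensor]
    exact N.lie_mem ht

variable (V hH lam) in
/-- The submodules of `V` correspond to those of `V ⊗ H(lam)`. -/
def tensorSubmoduleOrderIso :
    LieSubmodule ℂ Vir V ≃o LieSubmodule ℂ LL (Inflation V ⊗[ℂ] Osc hH lam) where
  toFun := tensorSubmodule hH lam
  invFun := fiberSubmodule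
  left_inv := fiberSubmodule_tensorSubmodule
  right_inv := tensorSubmodule_fiberSubmodule
  map_rel_iff' {V₁ V₂} := by
    constructor
    · intro h v hv
      change tensorSubmodule hH lam V₁ ≤ tensorSubmodule hH lam V₂ at h
      rw [← fiberSubmodule_tensorSubmodule (hH := hH) (lam := lam) V₂]
      exact fun m => h (tmul_mem_tensorSubmodule hv m)
    · rintro h _ ⟨t, rfl⟩
      induction t with
      | zero => simp
      | tmul v m => exact tmul_mem_tensorSubmodule (h v.2) m
      | add t u ht hu =>
        rw [map_add]
        exact add_mem ht hu

end Basic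

/-! ### Functoriality of inflations and oscillator representations -/

variable {V W H K : Type*}
  [AddCommGroup V] [Module ℂ V] [LieRingModule Vir V] [LieModule ℂ Vir V]
  [AddCommGroup W] [Module ℂ W] [LieRingModule Vir W] [LieModule ℂ Vir W]
  [AddCommGroup H] [Module ℂ H] [LieRingModule Heis H] [LieModule ℂ Heis H]
  [AddCommGroup K] [Module ℂ K] [LieRingModule Heis K] [LieModule ℂ Heis K]

/-- The equivalence of inflations induced by an equivalence of `Vir`-modules. -/
def Inflation.congr (e : V ≃ₗ⁅ℂ,Vir⁆ W) : Inflation V ≃ₗ⁅ℂ,LL⁆ Inflation W :=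
  .ofLinearEquiv ((Inflation.of V).symm ≪≫ₗ e.toLinearEquiv ≪≫ₗ Inflation.of W) fun x v =>
    e.toLieModuleHom.map_lie (proj x) ((Inflation.of V).symm v)

section Oscillator

variable (hH : IsChargedSimple H) (hK : IsChargedSimple K) (e : H ≃ₗ⁅ℂ,Heis⁆ K)

include e in
theorem IsChargedSimple.level_congr : hH.level = hK.level := by
  have := hH.nontrivial
  obtain ⟨v, hv⟩ := exists_ne (0 : H)
  have h := e.toLieModuleHom.map_lie Heis.z3 v
  rw [hH.z3_lie, hK.z3_lie, map_smul] at h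
  exact smul_left_injective ℂ (fun h0 => hv (e.injective (h0.trans (map_zero e).symm))) h

theorem map_opI (i : ℤ) (v : H) : e (opI H i v) = opI K i (e v) :=
  e.toLieModuleHom.map_lie (Heis.I i) v

theorem map_normalOrder (i j : ℤ) (v : H) : e (normalOrder H i j v) = normalOrder K i j (e v) := by
  unfold normalOrder
  split_ifs <;> simp only [Module.End.mul_apply, map_opI]

theorem IsChargedSimple.map_sumOp (k : ℤ) (v : H) : e (hH.sumOp k v) = hK.sumOp k (e v) := by
  change e (∑ᶠ i : ℤ, normalOrder H (-i) (i + k) v) =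
    ∑ᶠ i : ℤ, normalOrder K (-i) (i + k) (e v)
  simp only [← map_normalOrder]
  exact (e.toLinearEquiv.toLinearMap.toAddMonoidHom).map_finsum (hH.support_finite k v)

theorem IsChargedSimple.map_oscLin (lam : ℂ) (x : LL) (v : H) :
    e (hH.oscLin lam x v) = hK.oscLin lam x (e v) := by
  induction x using gen_induction with
  | hgen g =>
    rcases g with n | n | _ | _ | _
    · simp only [oscLin_d, opD_apply, map_add, map_smul, map_opI, hH.map_sumOp hK e,
        hH.level_congr hK e]
    · simp only [oscLin_I, map_opI]
    all_goals simp [oscLin_z1, oscLin_z2, oscLin_z3, hH.level_congr hK e]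
  | hadd x y hx hy => simp only [map_add, LinearMap.add_apply, hx, hy]
  | hsmul c x hx => simp only [map_smul, LinearMap.smul_apply, hx]

/-- The equivalence of oscillator representations induced by an equivalence of `Heis`-modules. -/
def Osc.congr (lam : ℂ) : Osc hH lam ≃ₗ⁅ℂ,LL⁆ Osc hK lam :=
  .ofLinearEquiv ((Osc.of hH lam).symm ≪≫ₗ e.toLinearEquiv ≪≫ₗ Osc.of hK lam) fun x v =>
    hH.map_oscLin hK e lam x ((Osc.of hH lam).symm v)

end Oscillator

/-! ### Isomorphisms of tensor products -/

variable {hH : IsChargedSimple H} {hK : IsChargedSimple K} {lam mu : ℂ}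

omit [LieRingModule Vir V] [LieModule ℂ Vir V] [LieModule ℂ Heis H] in
theorem nontrivial_tensor (hH : IsChargedSimple H) (lam : ℂ) [Nontrivial V] :
    Nontrivial (Inflation V ⊗[ℂ] Osc hH lam) := by
  have : Nontrivial (Inflation V) := ‹Nontrivial V›
  obtain ⟨h, hh⟩ := exists_ne (0 : Osc hH lam)
  exact (TensorProduct.tmul_left_injective (V := Inflation V) hh).nontrivial

omit [LieRingModule Vir V] [LieModule ℂ Vir V] [LieModule ℂ Heis H] in
theorem nontrivial_of_nontrivial_tensor [Nontrivial (Inflation V ⊗[ℂ] Osc hH lam)] :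
    Nontrivial V := by
  by_contra h
  have : Subsingleton (Inflation V) := not_nontrivial_iff_subsingleton.mp h
  exact not_subsingleton (Inflation V ⊗[ℂ] Osc hH lam) inferInstance

/-- The central element `z2` acts by `lam` on one side and by `mu` on the other. -/
theorem param_eq_of_equiv [Nontrivial (Inflation V ⊗[ℂ] Osc hH lam)]
    (Φ : (Inflation V ⊗[ℂ] Osc hH lam) ≃ₗ⁅ℂ,LL⁆ (Inflation W ⊗[ℂ] Osc hK mu)) : lam = mu := by
  obtain ⟨t, ht⟩ := exists_ne (0 : Inflation V ⊗[ℂ] Osc hH lam)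
  have h := Φ.toLieModuleHom.map_lie (gen .z2) t
  rw [z2_lie, z2_lie, map_smul] at h
  exact smul_left_injective ℂ (fun h0 => ht (Φ.injective (h0.trans (map_zero Φ).symm))) h

theorem map_heis_lTensor
    (Φ : (Inflation V ⊗[ℂ] Osc hH lam) ≃ₗ⁅ℂ,LL⁆ (Inflation W ⊗[ℂ] Osc hK mu)) (x : Heis)
    (t : Inflation V ⊗[ℂ] Osc hH lam) :
    Φ ((LieModule.toEnd ℂ Heis (Osc hH lam) x).lTensor (Inflation V) t) =
      (LieModule.toEnd ℂ Heis (Osc hK mu) x).lTensor (Inflation W) (Φ t) := by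
  rw [← heis_lie_eq_lTensor, ← heis_lie_eq_lTensor]
  exact Φ.toLieModuleHom.map_lie (x : LL) t

/-- Restricting an isomorphism to a line `v ⊗ H` and contracting with a functional on `W` gives a
homomorphism from `H` to `K`, nonzero for a suitable functional. -/
theorem nonempty_heis_equiv_of_equiv [Nontrivial V]
    (Φ : (Inflation V ⊗[ℂ] Osc hH lam) ≃ₗ⁅ℂ,LL⁆ (Inflation W ⊗[ℂ] Osc hK mu)) :
    Nonempty (H ≃ₗ⁅ℂ,Heis⁆ K) := by
  have := hH.nontrivial
  obtain ⟨v, hv⟩ := exists_ne (0 : V)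
  obtain ⟨h, hh⟩ := exists_ne (0 : H)
  have ht : Φ (Inflation.of V v ⊗ₜ Osc.of hH lam h) ≠ 0 := fun h0 => by
    have h1 := Φ.injective (h0.trans (map_zero Φ).symm)
    rw [← TensorProduct.zero_tmul (Inflation V) (Osc.of hH lam h)] at h1
    have h2 := TensorProduct.tmul_left_injective
      ((Osc.of hH lam).map_ne_zero_iff.mpr hh) h1
    exact hv ((Inflation.of V).map_eq_zero_iff.mp h2)
  obtain ⟨φ, hφ⟩ := TensorProduct.exists_contractFst_ne_zero ht
  let T : H →ₗ[ℂ] K := (Osc.of hK mu).symm.toLinearMap ∘ₗ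
    TensorProduct.contractFst (Osc hK mu) φ ∘ₗ Φ.toLinearEquiv.toLinearMap ∘ₗ
    TensorProduct.mk ℂ (Inflation V) (Osc hH lam) (Inflation.of V v) ∘ₗ
    (Osc.of hH lam).toLinearMap
  have hT (h : H) : Osc.of hK mu (T h) = TensorProduct.contractFst (Osc hK mu) φ
      (Φ (Inflation.of V v ⊗ₜ Osc.of hH lam h)) := rfl
  have hlie (x : Heis) (h : H) : T ⁅x, h⁆ = ⁅x, T h⁆ := by
    apply (Osc.of hK mu).injective
    rw [← Osc.heis_lie_of, hT, hT, ← Osc.heis_lie_of]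
    have h1 := map_heis_lTensor Φ x (Inflation.of V v ⊗ₜ Osc.of hH lam h)
    rw [LinearMap.lTensor_tmul] at h1
    exact (congrArg _ h1).trans (TensorProduct.contractFst_lTensor _ _ _)
  exact LieModuleHom.nonempty_equiv_of_isIrreducible hH.simple hK.simple
    { T with map_lie' := hlie _ _ } (m := h) ((Osc.of hK mu).map_ne_zero_iff.mp hφ)

/-- By density an `LL`-linear map `V ⊗ H(lam) → W ⊗ H(lam)` commutes with every operator `id ⊗ f`,
so it has the form `g ⊗ id`. -/
theorem exists_linearMap_tmul
    (Φ : (Inflation V ⊗[ℂ] Osc hH lam) ≃ₗ⁅ℂ,LL⁆ (Inflation W ⊗[ℂ] Osc hH lam)) :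
    ∃ g : V →ₗ[ℂ] W, ∀ (v : V) (h : Osc hH lam),
      Φ (Inflation.of V v ⊗ₜ h) = Inflation.of W (g v) ⊗ₜ h := by
  obtain ⟨h₀, hh₀⟩ := exists_ne (0 : Osc hH lam)
  obtain ⟨φ, hφ⟩ := Module.Projective.exists_dual_eq_one ℂ hh₀
  refine ⟨(Inflation.of W).symm.toLinearMap ∘ₗ TensorProduct.contractSnd (Inflation W) φ ∘ₗ
    Φ.toLinearEquiv.toLinearMap ∘ₗ
    (TensorProduct.mk ℂ (Inflation V) (Osc hH lam)).flip h₀ ∘ₗ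
    (Inflation.of V).toLinearMap, fun v h => ?_⟩
  have h1 := (Osc.isIrreducible_heis hH lam).map_lTensor Heis.countable_generators
    Heis.span_eq_top Φ.toLinearEquiv.toLinearMap (map_heis_lTensor Φ) (φ.smulRight h)
    (Inflation.of V v ⊗ₜ h₀)
  rwa [TensorProduct.lTensor_smulRight, TensorProduct.lTensor_smulRight,
    TensorProduct.contractSnd_tmul, hφ, one_smul] at h1

/-- The linear map `g` with `Φ = g ⊗ id` is equivariant, and the one belonging to `Φ.symm` inverts
it. -/
theorem nonempty_vir_equiv_of_equiv
    (Φ : (Inflation V ⊗[ℂ] Osc hH lam) ≃ₗ⁅ℂ,LL⁆ (Inflation W ⊗[ℂ] Osc hH lam)) :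
    Nonempty (V ≃ₗ⁅ℂ,Vir⁆ W) := by
  obtain ⟨f, hf⟩ := exists_linearMap_tmul Φ
  obtain ⟨g, hg⟩ := exists_linearMap_tmul Φ.symm
  obtain ⟨h, hh⟩ := exists_ne (0 : Osc hH lam)
  have injV {v w : V} (hvw : Inflation.of V v ⊗ₜ[ℂ] h = Inflation.of V w ⊗ₜ h) : v = w :=
    (Inflation.of V).injective (TensorProduct.tmul_left_injective hh hvw)
  have injW {v w : W} (hvw : Inflation.of W v ⊗ₜ[ℂ] h = Inflation.of W w ⊗ₜ h) : v = w :=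
    (Inflation.of W).injective (TensorProduct.tmul_left_injective hh hvw)
  refine ⟨.ofLinearEquiv (.ofLinearMap f g ?_ ?_) fun x v => injW ?_⟩
  · ext w
    refine injW ?_
    rw [LinearMap.comp_apply, ← hf, ← hg, LieModuleEquiv.apply_symm_apply, LinearMap.id_apply]
  · ext v
    refine injV ?_
    rw [LinearMap.comp_apply, ← hg, ← hf, LieModuleEquiv.symm_apply_apply, LinearMap.id_apply]
  · have h1 := Φ.toLieModuleHom.map_lie (x : LL) (Inflation.of V v ⊗ₜ h)
    rw [vir_lie_tmul, map_add, LieModuleEquiv.coe_toLieModuleHom, hf, hf, hf, vir_lie_tmul] at h1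
    exact add_right_cancel h1

end HeisVir

end

theorem mainTheorem4
    {V W H K : Type*}
    [AddCommGroup V] [Module ℂ V] [LieRingModule HeisVir.Vir V] [LieModule ℂ HeisVir.Vir V]
    [AddCommGroup W] [Module ℂ W] [LieRingModule HeisVir.Vir W] [LieModule ℂ HeisVir.Vir W]
    [AddCommGroup H] [Module ℂ H] [LieRingModule HeisVir.Heis H] [LieModule ℂ HeisVir.Heis H]
    [AddCommGroup K] [Module ℂ K] [LieRingModule HeisVir.Heis K] [LieModule ℂ HeisVir.Heis K]
    (hH : HeisVir.IsChargedSimple H) (hK : HeisVir.IsChargedSimple K) (lam mu : ℂ) :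
    (∀ N : LieSubmodule ℂ HeisVir.LL (HeisVir.Inflation V ⊗[ℂ] HeisVir.Osc hH lam),
      ∃ V' : LieSubmodule ℂ HeisVir.Vir V,
        N = (TensorProduct.LieModule.map (HeisVir.inflationSubmodule V').incl
          (LieModuleHom.id : HeisVir.Osc hH lam →ₗ⁅ℂ,HeisVir.LL⁆ HeisVir.Osc hH lam)).range) ∧
    (LieModule.IsIrreducible ℂ HeisVir.LL (HeisVir.Inflation V ⊗[ℂ] HeisVir.Osc hH lam) ↔
      LieModule.IsIrreducible ℂ HeisVir.Vir V) ∧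
    (Nontrivial V ∨ Nontrivial W →
      (Nonempty ((HeisVir.Inflation V ⊗[ℂ] HeisVir.Osc hH lam) ≃ₗ⁅ℂ,HeisVir.LL⁆
          (HeisVir.Inflation W ⊗[ℂ] HeisVir.Osc hK mu)) ↔
        lam = mu ∧ Nonempty (V ≃ₗ⁅ℂ,HeisVir.Vir⁆ W) ∧ Nonempty (H ≃ₗ⁅ℂ,HeisVir.Heis⁆ K))) := by
  refine ⟨fun N => ⟨HeisVir.fiberSubmodule N, (HeisVir.tensorSubmodule_fiberSubmodule N).symm⟩,
    (HeisVir.tensorSubmoduleOrderIso V hH lam).isSimpleOrder_iff.symm, fun hVW => ⟨?_, ?_⟩⟩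
  · rintro ⟨Φ⟩
    have hnt : Nontrivial (HeisVir.Inflation V ⊗[ℂ] HeisVir.Osc hH lam) := by
      rcases hVW with hV | hW
      · exact HeisVir.nontrivial_tensor hH lam
      · have := HeisVir.nontrivial_tensor (V := W) hK mu
        exact Φ.surjective.nontrivial
    have hV : Nontrivial V := HeisVir.nontrivial_of_nontrivial_tensor (hH := hH) (lam := lam)
    obtain rfl := HeisVir.param_eq_of_equiv Φ
    obtain ⟨e⟩ := HeisVir.nonempty_heis_equiv_of_equiv Φ
    exact ⟨rfl, HeisVir.nonempty_vir_equiv_of_equiv (Φ.trans (TensorProduct.LieModule.congr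
      (1 : _ ≃ₗ⁅ℂ,HeisVir.LL⁆ _) (HeisVir.Osc.congr hK hH e.symm lam))), ⟨e⟩⟩
  · rintro ⟨rfl, ⟨f⟩, ⟨e⟩⟩
    exact ⟨TensorProduct.LieModule.congr (HeisVir.Inflation.congr f)
      (HeisVir.Osc.congr hH hK e lam)⟩
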